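/- Let $\mathfrak g$ be an $n$-dimensional real Lie algebra with a stratification $\mathfrak g=\mathfrak g_1\oplus\cdots\oplus\mathfrak g_s$, that is, $\mathfrak g_{k+1}=[\mathfrak g_k,\mathfrak g_1]$ for $k\ge 1$, where $\mathfrak g_k=\{0\}$ for $k>s$ (the Lie algebra of a stratified nilpotent Lie group). Let $\mathrm{Prol}(\mathfrak g)=\bigoplus_{k\le s}\mathfrak g_k$ be its Tanaka prolongation: inductively for $k=0,1,2,\dots$, $\mathfrak g_{-k}$ is the space of linear maps $\phi:\mathfrak g\to\bigoplus_{i\ge 1-k}\mathfrak g_i$ such that $\phi(\mathfrak g_i)\subset\mathfrak g_{i-k}$ for all $i\ge 1$ and $\phi([X,Y])=[\phi(X),Y]+[X,\phi(Y)]$ for all $X,Y\in\mathfrak g$, and $[\phi,X]=-[X,\phi]=\phi(X)$ for $\phi\in\mathfrak g_{-k}$ and $X\in\mathfrak g$. Let $X_1,\dots,X_n$ be a basis of $\mathfrak g$, extended to a basis $\{X_j\}_{j\le n}$ of $\mathrm{Prol}(\mathfrak g)$ whose index $j$ ranges over all integers $j\le n$ or, if the prolongation is finite dimensional, over the integers $m\le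 j\le n$ for some integer $m\le 1$. Assume that each $X_j$ lies in a single $\mathfrak g_k$, write $d(j)=k$, and assume that $i<j$ implies $d(i)\le d(j)$. For $Y\in\mathrm{Prol}(\mathfrak g)$ and $\alpha\in\mathbb N^n=\{0,1,2,\dots\}^n$ let $[Y,X_\alpha]$ be the left-normed iterated commutator $$[Y,X_\alpha]=[\cdots[[Y,\underbrace{X_1],\dots,X_1}_{\alpha_1}],\dots,\underbrace{X_n],\dots,X_n}_{\alpha_n}],\qquad [Y,X_{(0,\dots,0)}]=Y,$$ and define $c_{i\alpha}^k\in\mathbb R$ by $[X_i,X_\alpha]=\sum_{k\le n}c_{i\alpha}^kX_k$. For $v\in\mathbb R^n$, with the convention $v_k=0$ for $k\le 0$, and for each index $i\le n$, define the extremal polynomial $$P_i^v(x)=\sum_{\alpha\in\mathbb N^n}\frac{(-1)^{|\alpha|}}{\alpha!}\Big(\sum_{k\le n}c_{i\alpha}^k v_k\Big)x^\alpha,\qquad x\in\mathbb R^n,$$ in which only finitely many terms are nonzero. Then: (i) $P_i^v(0)=v_i$ for all $i=1,\dots,n$ and all $v\in\mathbb R^n$. (ii) $P_i^v(0)=0$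 for all indices $i\le 0$ and all $v\in\mathbb R^n$. (iii) If $v\in\mathbb R^n$ is such that $P_i^v=0$ identically on $\mathbb R^n$ for all $i=1,\dots,n$ with $d(i)=1$, then $v=0$. -/

import Mathlib

open scoped DirectSum

universe u

/-- A stratification `g = g_1 ⊕ ⋯ ⊕ g_s` of a real Lie algebra. The layers are indexed by `ℤ`,
with `layer k = g_k` for `1 ≤ k ≤ s` and `layer k = 0` for all other `k`. -/
structure Stratification (g : Type u) [LieRing g] [LieAlgebra ℝ g] where
  layer : ℤ → Submodule ℝ g
  step : ℕ
  layer_of_nonpos : ∀ k : ℤ, k ≤ 0 → layer k = ⊥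
  layer_of_step_lt : ∀ k : ℤ, (step : ℤ) < k → layer k = ⊥
  isInternal : DirectSum.IsInternal layer
  layer_succ : ∀ k : ℤ, 1 ≤ k →
    layer (k + 1) = Submodule.span ℝ {z | ∃ x ∈ layer k, ∃ y ∈ layer 1, z = ⁅x, y⁆}

/-! ### The Tanaka prolongation -/

/-- A partial prolongation of `g`: a real vector space `carrier = ⨁_{i ≥ 1 - k} g_i` with its
homogeneous components `piece i = g_i` and the bracket `act m Y = [m, Y]` of `m ∈ carrier`
with `Y ∈ g`. -/
structure PartialProlongation (g : Type u) [LieRing g] [LieAlgebra ℝ g] where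
  carrier : Type u
  [addCommGroup : AddCommGroup carrier]
  [module : Module ℝ carrier]
  piece : ℤ → Submodule ℝ carrier
  act : carrier →ₗ[ℝ] g →ₗ[ℝ] carrier

attribute [instance] PartialProlongation.addCommGroup PartialProlongation.module

namespace Stratification

variable {g : Type u} [LieRing g] [LieAlgebra ℝ g] (S : Stratification g)

/-- The degree `-k` derivations of `g` with values in the partial prolongation `T`: the linear maps
`φ` with `φ (g_i) ⊆ g_{i-k}` and `φ [X, Y] = [φ X, Y] + [X, φ Y]`, where `[X, m] = -[m, X]`. -/
def derivations (T : PartialProlongation g) (k : ℕ) : Submodule ℝ (g →ₗ[ℝ] T.carrier) where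
  carrier := {φ | (∀ i : ℤ, ∀ X ∈ S.layer i, φ X ∈ T.piece (i - k)) ∧
    ∀ X Y : g, φ ⁅X, Y⁆ = T.act (φ X) Y - T.act (φ Y) X}
  zero_mem' := by simp
  add_mem' := by
    rintro φ ψ ⟨h1, h2⟩ ⟨h3, h4⟩
    refine ⟨fun i X hX => add_mem (h1 i X hX) (h3 i X hX), fun X Y => ?_⟩
    simp only [LinearMap.add_apply, map_add, h2, h4]
    abel
  smul_mem' := by
    rintro c φ ⟨h1, h2⟩
    refine ⟨fun i X hX => Submodule.smul_mem _ c (h1 i X hX), fun X Y => ?_⟩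
    simp only [LinearMap.smul_apply, map_smul, h2, smul_sub]

/-- One step of the construction: add to `T = ⨁_{i ≥ 1 - k} g_i` the component
`g_{-k} = derivations T k`, with the bracket `[φ, Y] = φ Y` for `φ ∈ g_{-k}` and `Y ∈ g`. -/
def next (T : PartialProlongation g) (k : ℕ) : PartialProlongation g where
  carrier := T.carrier × S.derivations T k
  piece i := (T.piece i).prod (if i = -(k : ℤ) then ⊤ else ⊥)
  act := (LinearMap.inl ℝ T.carrier (S.derivations T k)).compRight ℝ ∘ₗ
    (T.act ∘ₗ LinearMap.fst ℝ _ _ + (S.derivations T k).subtype ∘ₗ LinearMap.snd ℝ _ _)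

/-- `partialProl k = ⨁_{i ≥ 1 - k} g_i`; in particular `partialProl 0 = g`. -/
def partialProl : ℕ → PartialProlongation g
  | 0 =>
    { carrier := g
      piece := S.layer
      act := (LieModule.toEnd ℝ g g : g →ₗ[ℝ] g →ₗ[ℝ] g) }
  | k + 1 => S.next (partialProl k) k

/-- The component `g_{-k}`, `k ≥ 0`, of the Tanaka prolongation. -/
abbrev NegLayer (k : ℕ) : Type u := S.derivations (S.partialProl k) k

/-- The underlying vector space of the Tanaka prolongation `Prol(g) = g ⊕ ⨁_{k ≥ 0} g_{-k}`.
Its grading is `grade`, and its bracket with elements of `g`, the only bracket that enters the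
iterated commutators `[·, X_α]` below, is `bracket`. -/
abbrev Prol : Type u := g × ⨁ k : ℕ, S.NegLayer k

/-- The inclusion of `g` in its prolongation. -/
def ofG : g →ₗ[ℝ] S.Prol := LinearMap.inl ℝ g (⨁ k : ℕ, S.NegLayer k)

/-- The inclusion of `g_{-k}` in the prolongation. -/
def ofNeg (k : ℕ) : S.NegLayer k →ₗ[ℝ] S.Prol :=
  LinearMap.inr ℝ g (⨁ k : ℕ, S.NegLayer k) ∘ₗ DirectSum.lof ℝ ℕ (fun k => S.NegLayer k) k

/-- The inclusion of `⨁_{i ≥ 1 - k} g_i` in the prolongation. -/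
def incl : (k : ℕ) → (S.partialProl k).carrier →ₗ[ℝ] S.Prol
  | 0 => S.ofG
  | k + 1 => incl k ∘ₗ LinearMap.fst ℝ (S.partialProl k).carrier (S.NegLayer k) +
      S.ofNeg k ∘ₗ LinearMap.snd ℝ (S.partialProl k).carrier (S.NegLayer k)

/-- The homogeneous component of degree `i ∈ ℤ` of the prolongation: it is `g_i` for `i ≥ 1`, and
the space `NegLayer k` of derivations for `i = -k ≤ 0`. -/
def grade (i : ℤ) : Submodule ℝ S.Prol :=
  (S.layer i).map S.ofG ⊔ ⨆ (k : ℕ) (_ : i = -(k : ℤ)), LinearMap.range (S.ofNeg k)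

/-- The bracket `[Y, X]` of `Y ∈ Prol(g)` with `X ∈ g`: the bracket of `g` if `Y ∈ g`, and
`[φ, X] = φ X` for `φ ∈ g_{-k}`. -/
def bracket : S.Prol →ₗ[ℝ] g →ₗ[ℝ] S.Prol :=
  LinearMap.coprod (S.ofG.compRight ℝ ∘ₗ (LieModule.toEnd ℝ g g : g →ₗ[ℝ] g →ₗ[ℝ] g))
    (DirectSum.toModule ℝ ℕ (g →ₗ[ℝ] S.Prol) fun k =>
      (S.incl k).compRight ℝ ∘ₗ (S.derivations (S.partialProl k) k).subtype)

theorem bracket_ofG (Y X : g) : S.bracket (S.ofG Y) X = S.ofG ⁅Y, X⁆ := by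
  simp [bracket, ofG]

theorem bracket_ofNeg (k : ℕ) (φ : S.NegLayer k) (X : g) :
    S.bracket (S.ofNeg k φ) X = S.incl k (φ.1 X) := by
  simp [bracket, ofNeg]

/-! ### The bracket respects the grading -/

theorem lie_mem_layer (i j : ℤ) (x y : g) (hx : x ∈ S.layer i) (hy : y ∈ S.layer j) :
    ⁅x, y⁆ ∈ S.layer (i + j) := by
  rcases le_or_gt j 0 with hj | hj
  · rw [S.layer_of_nonpos j hj, Submodule.mem_bot] at hy
    simp [hy]
  obtain ⟨m, rfl⟩ : ∃ m : ℕ, j = m + 1 := ⟨(j - 1).toNat, by omega⟩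
  clear hj
  induction m generalizing i x y with
  | zero =>
    rcases le_or_gt i 0 with hi | hi
    · rw [S.layer_of_nonpos i hi, Submodule.mem_bot] at hx
      simp [hx]
    · simp only [Nat.cast_zero, zero_add] at hy ⊢
      rw [S.layer_succ i hi]
      exact Submodule.subset_span ⟨x, hx, y, hy, rfl⟩
  | succ m ih =>
    rw [show ((m + 1 : ℕ) : ℤ) + 1 = ((m : ℤ) + 1) + 1 by push_cast; ring,
      S.layer_succ _ (by omega)] at hy
    induction hy using Submodule.span_induction with
    | mem z hz =>
      obtain ⟨a, ha, b, hb, rfl⟩ := hz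
      rw [leibniz_lie, ← lie_skew a ⁅x, b⁆, ← sub_eq_add_neg]
      have h1 : ∀ (i' : ℤ) (u w : g), u ∈ S.layer i' → w ∈ S.layer 1 → ⁅u, w⁆ ∈ S.layer (i' + 1) :=
        by
        intro i' u w hu hw
        rcases le_or_gt i' 0 with hi | hi
        · rw [S.layer_of_nonpos i' hi, Submodule.mem_bot] at hu
          simp [hu]
        · rw [S.layer_succ i' hi]
          exact Submodule.subset_span ⟨u, hu, w, hw, rfl⟩
      refine sub_mem ?_ ?_
      · have := h1 _ _ _ (ih i x a hx ha) hb
        convert this using 2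
        push_cast; ring
      · have := ih (i + 1) _ a (h1 i x b hx hb) ha
        convert this using 2
        push_cast; ring
    | zero => simp
    | add a b _ _ ha hb => rw [lie_add]; exact add_mem ha hb
    | smul c a _ ha => rw [lie_smul]; exact Submodule.smul_mem _ c ha

theorem ofG_mem_grade (i : ℤ) (x : g) (hx : x ∈ S.layer i) : S.ofG x ∈ S.grade i :=
  Submodule.mem_sup_left (Submodule.mem_map_of_mem hx)

theorem ofNeg_mem_grade (k : ℕ) (φ : S.NegLayer k) : S.ofNeg k φ ∈ S.grade (-(k : ℤ)) :=
  Submodule.mem_sup_right (Submodule.mem_iSup_of_mem k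
    (Submodule.mem_iSup_of_mem rfl ⟨φ, rfl⟩))

theorem incl_mem_grade (k : ℕ) (i : ℤ) (m : (S.partialProl k).carrier)
    (hm : m ∈ (S.partialProl k).piece i) : S.incl k m ∈ S.grade i := by
  induction k with
  | zero => exact S.ofG_mem_grade i m hm
  | succ k ih =>
    obtain ⟨m, φ⟩ := m
    obtain ⟨h1, h2⟩ := hm
    refine add_mem (ih m h1) ?_
    change S.ofNeg k φ ∈ S.grade i
    by_cases h : i = -(k : ℤ)
    · rw [h]; exact S.ofNeg_mem_grade k φ
    · have h2' : φ ∈ (if i = -(k : ℤ) then ⊤ else ⊥ : Submodule ℝ (S.NegLayer k)) := h2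
      rw [if_neg h, Submodule.mem_bot] at h2'
      rw [h2', map_zero]
      exact zero_mem _

theorem bracket_mem_grade (i j : ℤ) (y : S.Prol) (X : g) (hy : y ∈ S.grade i)
    (hX : X ∈ S.layer j) : S.bracket y X ∈ S.grade (i + j) := by
  suffices h : S.grade i ≤ (S.grade (i + j)).comap (S.bracket.flip X) from h hy
  refine sup_le ?_ (iSup_le fun k => iSup_le fun hk => ?_)
  · rintro _ ⟨x, hx, rfl⟩
    change S.bracket (S.ofG x) X ∈ S.grade (i + j)
    rw [bracket_ofG]
    exact S.ofG_mem_grade _ _ (S.lie_mem_layer i j x X hx hX)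
  · rintro _ ⟨φ, rfl⟩
    change S.bracket (S.ofNeg k φ) X ∈ S.grade (i + j)
    rw [bracket_ofNeg]
    have := S.incl_mem_grade k _ _ (φ.2.1 j X hX)
    rwa [show i + j = j - k by omega]

theorem grade_eq_bot (i : ℤ) (hi : (S.step : ℤ) < i) : S.grade i = ⊥ := by
  rw [grade, S.layer_of_step_lt i hi, Submodule.map_bot, bot_sup_eq]
  simp only [iSup_eq_bot]
  intro k hk
  omega

theorem mem_layer_of_ofG_mem (i : ℤ) (x : g) (hx : S.ofG x ∈ S.grade i) : x ∈ S.layer i := by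
  have h : S.grade i ≤ (S.layer i).comap (LinearMap.fst ℝ g (⨁ k : ℕ, S.NegLayer k)) := by
    refine sup_le ?_ (iSup_le fun k => iSup_le fun hk => ?_)
    · rintro _ ⟨x, hx, rfl⟩
      exact hx
    · rintro _ ⟨φ, rfl⟩
      exact (S.layer i).zero_mem
  exact h hx

end Stratification

/-! ### Adapted bases and extremal polynomials -/

/-- A basis `X_1, …, X_n` of `g` together with an extension to a homogeneous basis `{X_j}_{j ≤ n}`
of `Prol(g)`, ordered so that `i < j` implies `d(i) ≤ d(j)`. The index set is `{j ∈ ℤ : j ≤ n}`,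
or `{j ∈ ℤ : m ≤ j ≤ n}` when the prolongation is finite dimensional. The field `deg` is the
degree `d`, and the vector `X i` for `i : Fin n`, numbered from zero, has index `i + 1`. -/
structure AdaptedBasis {g : Type u} [LieRing g] [LieAlgebra ℝ g] (S : Stratification g)
    (n : ℕ) where
  X : Module.Basis (Fin n) ℝ g
  J : Set ℤ
  J_eq : J = Set.Iic (n : ℤ) ∨ ∃ m : ℤ, m ≤ 1 ∧ J = Set.Icc m (n : ℤ)
  ext : Module.Basis J ℝ S.Prol
  ext_eq : ∀ (i : Fin n) (h : (i : ℤ) + 1 ∈ J), ext ⟨(i : ℤ) + 1, h⟩ = S.ofG (X i)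
  deg : J → ℤ
  ext_mem : ∀ j, ext j ∈ S.grade (deg j)
  deg_le : ∀ i j, i < j → deg i ≤ deg j

namespace AdaptedBasis

variable {g : Type u} [LieRing g] [LieAlgebra ℝ g] {S : Stratification g} {n : ℕ}
  (B : AdaptedBasis S n)

/-- The index in `{1, …, n} ⊆ J` that corresponds to `i : Fin n`. -/
def idx (i : Fin n) : B.J := ⟨(i : ℤ) + 1, by
  rcases B.J_eq with h | ⟨m, hm, h⟩ <;> rw [h] <;> simp
  all_goals omega⟩

/-- The iterated commutator `[Y, X_α] = [Y, X_1, …, X_1, …, X_n, …, X_n]` (left normed), with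
each `X_j` repeated `α_j` times. -/
noncomputable def iteratedCommutator (Y : S.Prol) (α : Fin n →₀ ℕ) : S.Prol :=
  (List.finRange n).foldl (fun Z j => (fun W => S.bracket W (B.X j))^[α j] Z) Y

/-- The generalized structure constants `c_{iα}^k`, given by `[X_i, X_α] = ∑_k c_{iα}^k X_k`. -/
noncomputable def structureConst (i : B.J) (α : Fin n →₀ ℕ) : B.J →₀ ℝ :=
  B.ext.repr (B.iteratedCommutator (B.ext i) α)

/-- The coordinate `v_k` of `v ∈ ℝⁿ`, with `v_k = 0` for `k ≤ 0`. -/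
def coord (v : Fin n → ℝ) (k : ℤ) : ℝ :=
  if h : 1 ≤ k ∧ k ≤ n then v ⟨(k - 1).toNat, by omega⟩ else 0

/-- `φ_{iα}(v) = ((-1)^{|α|} / α!) ∑_k c_{iα}^k v_k`. -/
noncomputable def phi (i : B.J) (α : Fin n →₀ ℕ) (v : Fin n → ℝ) : ℝ :=
  (-1) ^ (∑ j, α j) / (∏ j, (α j).factorial : ℕ) *
    (B.structureConst i α).sum fun k c => c * coord v k

theorem idx_mem_layer (j : Fin n) : B.X j ∈ S.layer (B.deg (B.idx j)) := by
  apply S.mem_layer_of_ofG_mem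
  rw [← B.ext_eq j (B.idx j).2]
  exact B.ext_mem (B.idx j)

theorem one_le_deg (j : Fin n) : 1 ≤ B.deg (B.idx j) := by
  by_contra! h
  have h1 := B.idx_mem_layer j
  rw [S.layer_of_nonpos _ (by omega), Submodule.mem_bot] at h1
  exact B.X.ne_zero j h1

theorem iteratedCommutator_mem (Y : S.Prol) (d : ℤ) (hY : Y ∈ S.grade d) (α : Fin n →₀ ℕ) :
    B.iteratedCommutator Y α ∈ S.grade (d + ∑ j, α j * B.deg (B.idx j)) := by
  have hit : ∀ (j : Fin n) (m : ℕ) (d : ℤ) (Y : S.Prol), Y ∈ S.grade d →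
      (fun W => S.bracket W (B.X j))^[m] Y ∈ S.grade (d + m * B.deg (B.idx j)) := by
    intro j m
    induction m with
    | zero => intro d Y hY; simpa using hY
    | succ m ih =>
      intro d Y hY
      rw [Function.iterate_succ_apply]
      have := ih _ _ (S.bracket_mem_grade d _ Y _ hY (B.idx_mem_layer j))
      convert this using 2
      push_cast; ring
  have hl : ∀ (l : List (Fin n)) (d : ℤ) (Y : S.Prol), Y ∈ S.grade d →
      l.foldl (fun Z j => (fun W => S.bracket W (B.X j))^[α j] Z) Y ∈
        S.grade (d + (l.map fun j => α j * B.deg (B.idx j)).sum) := by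
    intro l
    induction l with
    | nil => intro d Y hY; simpa using hY
    | cons j l ih =>
      intro d Y hY
      rw [List.foldl_cons, List.map_cons, List.sum_cons, ← add_assoc]
      exact ih _ _ (hit j (α j) d Y hY)
  have := hl (List.finRange n) d Y hY
  rwa [← List.ofFn_eq_map, List.sum_ofFn] at this

/-- Only finitely many of the coefficients `φ_{iα}(v)` are nonzero. -/
theorem finite_support_phi (i : B.J) (v : Fin n → ℝ) : {α | B.phi i α v ≠ 0}.Finite := by
  refine (Set.finite_Iic (Finsupp.equivFunOnFinite.symm
    fun _ : Fin n => (S.step - B.deg i).toNat)).subset fun α hα => ?_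
  rw [Set.mem_Iic]
  intro j
  by_contra! hj
  apply hα
  have hle : (α j : ℤ) ≤ ∑ l, α l * B.deg (B.idx l) := by
    refine le_trans ?_ (Finset.single_le_sum (f := fun l => (α l : ℤ) * B.deg (B.idx l))
      (fun l _ => mul_nonneg (by positivity) (by linarith [B.one_le_deg l])) (Finset.mem_univ j))
    exact le_mul_of_one_le_right (by positivity) (B.one_le_deg j)
  have hj' : (S.step - B.deg i).toNat < α j := hj
  have h0 := B.iteratedCommutator_mem (B.ext i) _ (B.ext_mem i) α
  rw [S.grade_eq_bot _ (by omega), Submodule.mem_bot] at h0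
  simp [phi, structureConst, h0]

/-- The extremal polynomial `P_i^v(x) = ∑_{α ∈ ℕⁿ} φ_{iα}(v) x^α`. -/
noncomputable def extremalPolynomial (i : B.J) (v : Fin n → ℝ) : MvPolynomial (Fin n) ℝ :=
  ∑ α ∈ (B.finite_support_phi i v).toFinset, MvPolynomial.monomial α (B.phi i α v)

end AdaptedBasis

/-! The constant term of `P_i^v` is the term `α = 0`, and `[X_i, X_0] = X_i`, so its value is `v_i`,
which is `0` by convention for `i ≤ 0`. This gives (i) and (ii).

For (iii), let `λ` be the linear functional on `g` with `λ(X_k) = v_k`. Up to a nonzero factor the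
coefficient of `x^α` in `P_i^v` is `λ([X_i, X_α])`, so `λ` kills all `[X_i, X_α]` with `d(i) = 1`.
It remains to see that these span `g` (`orderedSpan_layer_one`). Unordered iterated brackets
starting in `g_1` span `g` by the stratification. A Poincaré–Birkhoff–Witt reordering
(`lie_mem_orderedSpan`) shows that ordered ones suffice: the correction `[X_i, X_j]` involves only
`X_k` with `k > j`, since brackets raise the degree. -/

/-! ### Ordered products of endomorphisms -/

/-- The span of the vectors `f jᵣ ^ mᵣ (⋯ (f j₁ ^ m₁ y))` with `y ∈ V`, where `l = [j₁, …, jᵣ]`. -/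
def orderedSpan {R ι M : Type*} [CommRing R] [AddCommGroup M] [Module R M]
    (f : ι → Module.End R M) : List ι → Submodule R M → Submodule R M
  | [], V => V
  | j :: l, V => orderedSpan f l (⨆ m : ℕ, V.map (f j ^ m))

section OrderedSpan

variable {R ι M : Type*} [CommRing R] [AddCommGroup M] [Module R M] (f : ι → Module.End R M)

theorem le_iSup_map_pow (V : Submodule R M) (j : ι) : V ≤ ⨆ m : ℕ, V.map (f j ^ m) := by
  refine le_trans (le_of_eq ?_) (le_iSup (fun m : ℕ => V.map (f j ^ m)) 0)
  rw [pow_zero]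
  exact (Submodule.map_id V).symm

theorem iSup_map_pow_le_comap (V : Submodule R M) (j : ι) :
    (⨆ m : ℕ, V.map (f j ^ m)) ≤ (⨆ m : ℕ, V.map (f j ^ m)).comap (f j) := by
  refine iSup_le fun m => ?_
  rintro _ ⟨y, hy, rfl⟩
  refine Submodule.mem_iSup_of_mem (m + 1) ⟨y, hy, ?_⟩
  rw [pow_succ']
  rfl

theorem le_orderedSpan (l : List ι) (V : Submodule R M) : V ≤ orderedSpan f l V := by
  induction l generalizing V with
  | nil => exact le_rfl
  | cons j l ih => exact (le_iSup_map_pow f V j).trans (ih _)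

theorem orderedSpan_le (l : List ι) (V N : Submodule R M) (hV : V ≤ N)
    (hN : ∀ j ∈ l, N ≤ N.comap (f j)) : orderedSpan f l V ≤ N := by
  induction l generalizing V with
  | nil => exact hV
  | cons j l ih =>
    refine ih _ (iSup_le fun m => ?_) fun i hi => hN i (List.mem_cons_of_mem _ hi)
    induction m with
    | zero =>
      rw [pow_zero]
      exact (Submodule.map_id V).le.trans hV
    | succ m hm =>
      rintro _ ⟨y, hy, rfl⟩
      rw [pow_succ']
      exact hN j List.mem_cons_self (hm ⟨y, hy, rfl⟩)

/-- Linearity of the ordered product lets a vanishing condition pass from generators to their span.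
-/
theorem exists_end_eq_foldl (α : ι → ℕ) (l : List ι) :
    ∃ F : Module.End R M, ∀ y, F y = l.foldl (fun z j => (f j ^ α j) z) y := by
  induction l with
  | nil => exact ⟨LinearMap.id, fun _ => rfl⟩
  | cons i l ih =>
    obtain ⟨F, hF⟩ := ih
    exact ⟨F * f i ^ α i, fun y => hF _⟩

theorem orderedSpan_le_ker [DecidableEq ι] {P : Type*} [AddCommGroup P] [Module R P]
    (l : List ι) (hl : l.Nodup) (V : Submodule R M) (φ : M →ₗ[R] P)
    (h : ∀ (α : ι → ℕ), ∀ y ∈ V, φ (l.foldl (fun z j => (f j ^ α j) z) y) = 0) :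
    orderedSpan f l V ≤ LinearMap.ker φ := by
  induction l generalizing V with
  | nil => exact fun y hy => h 0 y hy
  | cons j l ih =>
    obtain ⟨hj, hl⟩ := List.nodup_cons.1 hl
    refine ih hl _ fun α => ?_
    obtain ⟨F, hF⟩ := exists_end_eq_foldl f α l
    suffices hle : (⨆ m : ℕ, V.map (f j ^ m)) ≤ LinearMap.ker (φ ∘ₗ F) by
      intro y hy
      rw [← hF]
      exact hle hy
    refine iSup_le fun m => ?_
    rintro _ ⟨y, hy, rfl⟩
    -- As `j` does not occur in the tail, its exponent can be set to `m` without altering the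
    -- remaining factors.
    have := h (Function.update α j m) y hy
    rw [List.foldl_cons, Function.update_self] at this
    rw [LinearMap.mem_ker, LinearMap.comp_apply, hF, ← this]
    congr 1
    refine List.foldl_ext _ _ _ fun z i hi => ?_
    rw [Function.update_of_ne]
    rintro rfl
    exact hj hi

end OrderedSpan

/-! ### Ordered brackets in a Lie algebra -/

section OrderedBrackets

variable {R ι L : Type*} [CommRing R] [LieRing L] [LieAlgebra R L]

/-- The right bracket `y ↦ ⁅y, x⁆`. -/
def rightBracket (R : Type*) {L : Type*} [CommRing R] [LieRing L] [LieAlgebra R L] (x : L) :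
    Module.End R L :=
  (LieModule.toEnd R L L : L →ₗ[R] Module.End R L).flip x

@[simp]
theorem rightBracket_apply (x y : L) : rightBracket R x y = ⁅y, x⁆ := rfl

theorem lie_mem_of_mem_span {X : ι → L} {s : Set ι} {N : Submodule R L}
    (hN : ∀ i ∈ s, ∀ y ∈ N, ⁅y, X i⁆ ∈ N) {y z : L} (hy : y ∈ N)
    (hz : z ∈ Submodule.span R (X '' s)) : ⁅y, z⁆ ∈ N := by
  induction hz using Submodule.span_induction with
  | mem z hz =>
    obtain ⟨i, hi, rfl⟩ := hz
    exact hN i hi y hy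
  | zero => simp
  | add a b _ _ ha hb => rw [lie_add]; exact add_mem ha hb
  | smul c a _ ha => rw [lie_smul]; exact Submodule.smul_mem _ c ha

/-- The spanning half of the Poincaré–Birkhoff–Witt theorem, for a family that is triangular with
respect to a linear order: ordered iterated brackets span a submodule stable under all brackets. -/
theorem lie_mem_orderedSpan [LinearOrder ι] (X : ι → L)
    (hX : ∀ i j, j < i → ⁅X i, X j⁆ ∈ Submodule.span R (X '' Set.Ioi j))
    (l : List ι) (hsort : l.Pairwise (· < ·)) (hup : ∀ i ∈ l, ∀ k, i ≤ k → k ∈ l)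
    (V : Submodule R L) :
    ∀ i ∈ l, ∀ y ∈ orderedSpan (fun i => rightBracket R (X i)) l V,
      ⁅y, X i⁆ ∈ orderedSpan (fun i => rightBracket R (X i)) l V := by
  induction l generalizing V with
  | nil => simp
  | cons j l ih =>
    obtain ⟨hj, hsort⟩ := List.pairwise_cons.1 hsort
    have hup' : ∀ i ∈ l, ∀ k, i ≤ k → k ∈ l := fun i hi k hk =>
      (List.mem_cons.1 (hup i (List.mem_cons_of_mem _ hi) k hk)).resolve_left
        ((hj i hi).trans_le hk).ne'
    -- Upward closure puts every index above `j` in the tail, so stability under the tail covers the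
    -- brackets with `[X_i, X_j]`.
    have hIoi : ∀ k, j < k → k ∈ l := fun k hk =>
      (List.mem_cons.1 (hup j List.mem_cons_self k hk.le)).resolve_left hk.ne'
    rw [orderedSpan]
    set V' := ⨆ m : ℕ, V.map (rightBracket R (X j) ^ m) with hV'
    set N := orderedSpan (fun i => rightBracket R (X i)) l V' with hN
    have hl : ∀ i ∈ l, ∀ y ∈ N, ⁅y, X i⁆ ∈ N := ih hsort hup' V'
    -- The elements of `N` whose bracket with `X_j` stays in `N` include `V'` and are stable under
    -- the later brackets, by the Jacobi identity; hence they exhaust `N`.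
    have hle : N ≤ N ⊓ N.comap (rightBracket R (X j)) := by
      refine orderedSpan_le _ l V' _ (le_inf (le_orderedSpan _ l V') ?_) ?_
      · exact (iSup_map_pow_le_comap (fun i => rightBracket R (X i)) V j).trans
          (Submodule.comap_mono (le_orderedSpan _ l V'))
      · rintro i hi y ⟨hy, hyj⟩
        refine ⟨hl i hi y hy, ?_⟩
        change ⁅⁅y, X i⁆, X j⁆ ∈ N
        have hjac : ⁅⁅y, X i⁆, X j⁆ = ⁅⁅y, X j⁆, X i⁆ + ⁅y, ⁅X i, X j⁆⁆ := by
          rw [leibniz_lie y (X i) (X j), ← lie_skew (X i) ⁅y, X j⁆]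
          abel
        rw [hjac]
        exact add_mem (hl i hi _ hyj) (lie_mem_of_mem_span
          (fun k (hk : j < k) => hl k (hIoi k hk)) hy (hX i j (hj i hi)))
    intro i hi y hy
    rcases List.mem_cons.1 hi with rfl | hi
    · exact (hle hy).2
    · exact hl i hi y hy

end OrderedBrackets

/-! ### Ordered brackets from the first layer span the Lie algebra. -/

theorem Stratification.eq_top_of_layer_one_le {g : Type u} [LieRing g] [LieAlgebra ℝ g]
    (S : Stratification g) (N : Submodule ℝ g) (h1 : S.layer 1 ≤ N)
    (hN : ∀ y ∈ N, ∀ z, ⁅y, z⁆ ∈ N) : N = ⊤ := by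
  rw [eq_top_iff, ← S.isInternal.submodule_iSup_eq_top]
  refine iSup_le fun k => ?_
  rcases le_or_gt k 0 with hk | hk
  · rw [S.layer_of_nonpos k hk]
    exact bot_le
  · induction k, (show (1 : ℤ) ≤ k from hk) using Int.leInduction with
    | base => exact h1
    | succ k hk1 ih =>
      rw [S.layer_succ k hk1, Submodule.span_le]
      rintro _ ⟨x, hx, y, -, rfl⟩
      exact hN x (ih (by omega) hx) y

namespace AdaptedBasis

variable {g : Type u} [LieRing g] [LieAlgebra ℝ g] {S : Stratification g} {n : ℕ}
  (B : AdaptedBasis S n)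

theorem layer_le_span (e : ℤ) :
    S.layer e ≤ Submodule.span ℝ (B.X '' {k | B.deg (B.idx k) = e}) := by
  intro y hy
  set s := {k | B.deg (B.idx k) = e}
  have htop : Submodule.span ℝ (B.X '' s) ⊔ Submodule.span ℝ (B.X '' sᶜ) = ⊤ := by
    rw [← Submodule.span_union, ← Set.image_union, Set.union_compl_self, Set.image_univ,
      B.X.span_eq]
  obtain ⟨q, hq, r, hr, rfl⟩ := Submodule.mem_sup.1 (htop ▸ Submodule.mem_top : y ∈ _)
  have hqe : Submodule.span ℝ (B.X '' s) ≤ S.layer e := by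
    rw [Submodule.span_le]
    rintro _ ⟨k, hk, rfl⟩
    exact (show B.deg (B.idx k) = e from hk) ▸ B.idx_mem_layer k
  have hre : Submodule.span ℝ (B.X '' sᶜ) ≤ ⨆ (i : ℤ) (_ : i ≠ e), S.layer i := by
    rw [Submodule.span_le]
    rintro _ ⟨k, hk, rfl⟩
    exact Submodule.mem_iSup_of_mem _ (Submodule.mem_iSup_of_mem hk (B.idx_mem_layer k))
  -- The remainder `r = y - q` lies both in `g_e` and in the sum of the other layers.
  have hr0 : r = 0 := Submodule.disjoint_def.1 (S.isInternal.submodule_iSupIndep e) r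
    (by simpa using sub_mem hy (hqe hq)) (hre hr)
  rwa [hr0, add_zero]

theorem idx_lt_idx {i j : Fin n} (h : i < j) : B.idx i < B.idx j := by
  rw [← Subtype.coe_lt_coe]
  simp only [idx]
  have : (i : ℕ) < j := h
  omega

/-- The bracket has degree `d(i) + d(j) > d(j)`, and since `d` is monotone, basis vectors of that
degree have index above `j`. -/
theorem lie_mem_span_Ioi (i j : Fin n) :
    ⁅B.X i, B.X j⁆ ∈ Submodule.span ℝ (B.X '' Set.Ioi j) := by
  refine Submodule.span_mono (Set.image_mono fun k hk => ?_)
    (B.layer_le_span _ (S.lie_mem_layer _ _ _ _ (B.idx_mem_layer i) (B.idx_mem_layer j)))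
  by_contra hkj
  have hle : B.deg (B.idx k) ≤ B.deg (B.idx j) := by
    rcases (not_lt.1 (show ¬ j < k from hkj)).lt_or_eq with h | rfl
    · exact B.deg_le _ _ (B.idx_lt_idx h)
    · exact le_rfl
  have := B.one_le_deg i
  have hk' : B.deg (B.idx k) = B.deg (B.idx i) + B.deg (B.idx j) := hk
  omega

theorem orderedSpan_layer_one :
    orderedSpan (fun j => rightBracket ℝ (B.X j)) (List.finRange n) (S.layer 1) = ⊤ := by
  refine S.eq_top_of_layer_one_le _ (le_orderedSpan _ _ _) fun y hy z => ?_
  refine lie_mem_of_mem_span (X := B.X) (s := Set.univ) (fun i _ => ?_) hy ?_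
  · exact lie_mem_orderedSpan (R := ℝ) B.X (fun i j _ => B.lie_mem_span_Ioi i j) _
      (List.pairwise_lt_finRange n) (fun _ _ k _ => List.mem_finRange k) _ i (List.mem_finRange i)
  · rw [Set.image_univ, B.X.span_eq]
    exact Submodule.mem_top

/-! ### Coefficients of the extremal polynomials. -/

theorem ext_idx (i : Fin n) : B.ext (B.idx i) = S.ofG (B.X i) := B.ext_eq i (B.idx i).2

/-- For a start in `g` the commutators never leave `g`, so the negative layers play no role in
(iii). -/
theorem iteratedCommutator_ofG (y : g) (α : Fin n →₀ ℕ) :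
    B.iteratedCommutator (S.ofG y) α =
      S.ofG ((List.finRange n).foldl (fun z j => (rightBracket ℝ (B.X j) ^ α j) z) y) := by
  have hit : ∀ (j : Fin n) (m : ℕ) (y : g), (fun W => S.bracket W (B.X j))^[m] (S.ofG y) =
      S.ofG ((rightBracket ℝ (B.X j) ^ m) y) := by
    intro j m
    induction m with
    | zero => intro y; rfl
    | succ m ih =>
      intro y
      rw [Function.iterate_succ_apply, S.bracket_ofG, ih, pow_succ]
      rfl
  have hl : ∀ (l : List (Fin n)) (y : g),
      l.foldl (fun Z j => (fun W => S.bracket W (B.X j))^[α j] Z) (S.ofG y) =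
        S.ofG (l.foldl (fun z j => (rightBracket ℝ (B.X j) ^ α j) z) y) := by
    intro l
    induction l with
    | nil => intro y; rfl
    | cons j l ih =>
      intro y
      rw [List.foldl_cons, List.foldl_cons, hit, ih]
  exact hl _ y

theorem iteratedCommutator_zero (Y : S.Prol) : B.iteratedCommutator Y 0 = Y := by
  have hl : ∀ l : List (Fin n), l.foldl
      (fun Z j => (fun W => S.bracket W (B.X j))^[(0 : Fin n →₀ ℕ) j] Z) Y = Y := by
    intro l
    induction l with
    | nil => rfl
    | cons j l ih => exact ih
  exact hl _

theorem coord_idx (v : Fin n → ℝ) (i : Fin n) : coord v (B.idx i) = v i := by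
  have h : (1 : ℤ) ≤ (B.idx i : ℤ) ∧ (B.idx i : ℤ) ≤ n := by
    simp only [idx]
    omega
  rw [coord, dif_pos h]
  congr 1
  ext
  simp [idx]

/-- The linear functional on `g` with value `v_k` at `X_k`. -/
noncomputable def functional (v : Fin n → ℝ) : g →ₗ[ℝ] ℝ := B.X.constr ℝ v

theorem sum_repr_ofG (v : Fin n → ℝ) (z : g) :
    ((B.ext.repr (S.ofG z)).sum fun k c => c * coord v k) = B.functional v z := by
  have h : Finsupp.linearCombination ℝ (fun k : B.J => coord v k) ∘ₗ
      B.ext.repr.toLinearMap ∘ₗ S.ofG = B.functional v := by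
    refine B.X.ext fun i => ?_
    simp [← ext_idx, functional, coord_idx]
  rw [← h]
  rfl

theorem phi_zero (i : B.J) (v : Fin n → ℝ) : B.phi i 0 v = coord v i := by
  simp [phi, structureConst, iteratedCommutator_zero]

theorem coeff_extremalPolynomial (i : B.J) (v : Fin n → ℝ) (α : Fin n →₀ ℕ) :
    (B.extremalPolynomial i v).coeff α = B.phi i α v := by
  classical
  simp only [extremalPolynomial, MvPolynomial.coeff_sum, MvPolynomial.coeff_monomial,
    Finset.sum_ite_eq', Set.Finite.mem_toFinset, Set.mem_ofPred_eq]
  split_ifs with h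
  · rfl
  · exact (not_not.1 h).symm

theorem eval_zero_extremalPolynomial (i : B.J) (v : Fin n → ℝ) :
    MvPolynomial.eval 0 (B.extremalPolynomial i v) = coord v i := by
  rw [← B.phi_zero i v, ← B.coeff_extremalPolynomial i v 0, MvPolynomial.eval_zero,
    MvPolynomial.constantCoeff_eq]

theorem functional_foldl_eq_zero (v : Fin n → ℝ) (i : Fin n) (α : Fin n →₀ ℕ)
    (h : B.phi (B.idx i) α v = 0) :
    B.functional v ((List.finRange n).foldl
      (fun z j => (rightBracket ℝ (B.X j) ^ α j) z) (B.X i)) = 0 := by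
  rw [phi, structureConst, ext_idx, iteratedCommutator_ofG, sum_repr_ofG] at h
  refine (mul_eq_zero.1 h).resolve_left (div_ne_zero (pow_ne_zero _ (by norm_num)) ?_)
  exact_mod_cast Finset.prod_ne_zero_iff.2 fun j _ => Nat.factorial_ne_zero _

theorem eq_zero_of_phi_eq_zero (v : Fin n → ℝ)
    (h : ∀ i, B.deg (B.idx i) = 1 → ∀ α, B.phi (B.idx i) α v = 0) : v = 0 := by
  set V := Submodule.span ℝ (B.X '' {k | B.deg (B.idx k) = 1}) with hV
  -- The hypothesis concerns only basis vectors of degree one, while the ordered span starts from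
  -- the whole first layer.
  have hlayer : S.layer 1 = V := by
    refine le_antisymm (B.layer_le_span 1) (Submodule.span_le.2 ?_)
    rintro _ ⟨k, hk, rfl⟩
    exact (show B.deg (B.idx k) = 1 from hk) ▸ B.idx_mem_layer k
  have hker : (⊤ : Submodule ℝ g) ≤ LinearMap.ker (B.functional v) := by
    rw [← B.orderedSpan_layer_one]
    refine orderedSpan_le_ker _ _ (List.nodup_finRange n) _ _ fun α y hy => ?_
    obtain ⟨F, hF⟩ := exists_end_eq_foldl (fun j => rightBracket ℝ (B.X j)) α (List.finRange n)
    have hle : V ≤ LinearMap.ker (B.functional v ∘ₗ F) := by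
      rw [hV, Submodule.span_le]
      rintro _ ⟨i, hi, rfl⟩
      have := B.functional_foldl_eq_zero v i (Finsupp.equivFunOnFinite.symm α) (h i hi _)
      rw [SetLike.mem_coe, LinearMap.mem_ker, LinearMap.comp_apply, hF]
      exact this
    rw [← hF]
    exact hle (hlayer ▸ hy)
  ext i
  have := hker (Submodule.mem_top : B.X i ∈ _)
  rwa [LinearMap.mem_ker, functional, Module.Basis.constr_basis] at this

end AdaptedBasis

theorem proposition2p5 {g : Type u} [LieRing g] [LieAlgebra ℝ g] (S : Stratification g)
    (n : ℕ) (B : AdaptedBasis S n) :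
    (∀ (i : Fin n) (v : Fin n → ℝ),
      MvPolynomial.eval 0 (B.extremalPolynomial (B.idx i) v) = v i) ∧
    (∀ (i : B.J) (v : Fin n → ℝ), (i : ℤ) ≤ 0 →
      MvPolynomial.eval 0 (B.extremalPolynomial i v) = 0) ∧
    (∀ v : Fin n → ℝ,
      (∀ i : Fin n, B.deg (B.idx i) = 1 →
        ∀ x : Fin n → ℝ, MvPolynomial.eval x (B.extremalPolynomial (B.idx i) v) = 0) →
      v = 0) := by
  refine ⟨fun i v => ?_, fun i v hi => ?_, fun v h => ?_⟩
  · rw [B.eval_zero_extremalPolynomial, B.coord_idx]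
  · rw [B.eval_zero_extremalPolynomial, AdaptedBasis.coord, dif_neg (by omega)]
  · refine B.eq_zero_of_phi_eq_zero v fun i hi α => ?_
    -- Over the infinite field `ℝ`, a polynomial that vanishes as a function has zero coefficients.
    have hP : B.extremalPolynomial (B.idx i) v = 0 :=
      MvPolynomial.funext fun x => by rw [h i hi x, map_zero]
    rw [← B.coeff_extremalPolynomial, hP, MvPolynomial.coeff_zero]
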